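/- Let $0\le n<N$ be integers, let $\zeta_j=e^{i\pi j/N}$ for $j=-N+1,\dots,N$, and let $\nu$ be the uniform probability measure on these $2N$ points. Let $\mathfrak P$ be the real vector space of symmetric trigonometric polynomials $P(z)=\sum_{k=-n}^n p_kz^{-k}$ with $p_{-k}=\bar p_k$ (so $p_0\in\mathbb R$), with its usual finite-dimensional topology, and let $\mathfrak P_+(N)=\{P\in\mathfrak P : P(\zeta_j)>0,\ j=-N+1,\dots,N\}$. Let $\mathfrak C_+(N)$ be the set of all $c=(c_0,\dots,c_n)\in\mathbb R\times\mathbb C^n$ such that, with $c_{-k}=\bar c_k$, $\sum_{k=-n}^n c_k\bar p_k>0$ for every nonzero $P$ in the closure of $\mathfrak P_+(N)$. 1. For each $P\in\mathfrak P_+(N)$, the moment map $$F^P:\mathfrak P_+(N)\to\mathfrak C_+(N),\qquad F^P_k(Q)=\int z^k\,\frac{P(z)}{Q(z)}\,d\nu(z)=\frac1{2N}\sum_{j=-N+1}^N\zeta_j^k\,\frac{P(\zeta_j)}{Q(\zeta_j)},\quad k=0,1,\dots,n,$$ is a homeomorphism onto $\mathfrak C_+(N)$. 2. For each $c\in\mathfrak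 C_+(N)$, let $G^c$ be the map sending $P\in\mathfrak P_+(N)$ to the unique $Q\in\mathfrak P_+(N)$ with $F^P(Q)=c$. Then $G^c$ is a homeomorphism of $\mathfrak P_+(N)$ onto the set $\{Q\in\mathfrak P_+(N) : F^P(Q)=c\text{ for some }P\in\mathfrak P_+(N)\}$ of all solutions for $c$. All of these sets are open (in $\mathfrak P$ and in $\mathbb R\times\mathbb C^n$, respectively), and $F^P$, $G^c$ and their inverses are $C^\infty$. In particular, for each $c\in\mathfrak C_+(N)$, $G^c$ is a complete smooth parameterization of all solutions $Q$ by $P\in\mathfrak P_+(N)$. -/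

import Mathlib

open Set
open scoped ContDiff ComplexConjugate

noncomputable section

/-- The real vector space of tuples `(p₀, p₁, …, pₙ)` with `p₀` real and `p₁, …, pₙ` complex.
It holds both the covariance data `(c₀, …, cₙ)` and the symmetric trigonometric polynomials
`P(z) = ∑_{k=-n}^n p_k z^{-k}`, `p_{-k} = conj p_k`, given by their coefficients. -/
abbrev HermCoeffs (n : ℕ) : Type := ℝ × (Fin n → ℂ)

/-- The two-sided coefficient sequence: `p_{-k} = conj p_k`, and `p_k = 0` for `|k| > n`. -/
def HermCoeffs.coeff {n : ℕ} (p : HermCoeffs n) (k : ℤ) : ℂ :=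
  if k = 0 then (p.1 : ℂ)
  else if h : k.natAbs - 1 < n then
    (if 0 < k then p.2 ⟨k.natAbs - 1, h⟩ else conj (p.2 ⟨k.natAbs - 1, h⟩))
  else 0

/-- `P(z) = ∑_{k=-n}^n p_k z^{-k}`. -/
def HermCoeffs.eval {n : ℕ} (p : HermCoeffs n) (z : ℂ) : ℂ :=
  ∑ k ∈ Finset.Icc (-(n : ℤ)) n, p.coeff k * z ^ (-k)

/-- The points `ζ_j = exp(i π j / N)` of the discrete unit circle `𝕋_{2N}`. -/
def zetaPt (N : ℕ) (j : ℤ) : ℂ := Complex.exp (Complex.I * (Real.pi * j / N))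

/-- The integral `∫ f dν = (1/2N) ∑_{j=-N+1}^N f(ζ_j)` against the uniform probability measure
on the discrete unit circle. -/
def discreteIntegral (N : ℕ) (f : ℂ → ℂ) : ℂ :=
  (1 / (2 * (N : ℂ))) * ∑ j ∈ Finset.Icc (-(N : ℤ) + 1) N, f (zetaPt N j)

/-- The cone `𝔓₊(N)`: `P(ζ_j) > 0` for `j = -N+1, …, N`. The values `P(ζ_j)` are real, see
`HermCoeffs.eval_im`. -/
def posCone (n N : ℕ) : Set (HermCoeffs n) :=
  {P | ∀ j ∈ Finset.Icc (-(N : ℤ) + 1) N, 0 < (P.eval (zetaPt N j)).re}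

/-- `⟨C, P⟩ = ∑_{k=-n}^n c_k conj p_k`, a real number, see `pairing_im`. -/
def pairing {n : ℕ} (c p : HermCoeffs n) : ℂ :=
  ∑ k ∈ Finset.Icc (-(n : ℤ)) n, c.coeff k * conj (p.coeff k)

/-- The (open) dual cone `ℭ₊(N)`: `⟨C, P⟩ > 0` for all nonzero `P` in the closure of `𝔓₊(N)`. -/
def dualCone (n N : ℕ) : Set (HermCoeffs n) :=
  {c | ∀ P ∈ closure (posCone n N), P ≠ 0 → 0 < (pairing c P).re}

/-- The moment `∫ e^{ikθ} P(e^{iθ}) / Q(e^{iθ}) dν`. -/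
def ratMoment {n : ℕ} (N : ℕ) (P Q : HermCoeffs n) (k : ℤ) : ℂ :=
  discreteIntegral N fun z => z ^ k * (P.eval z / Q.eval z)

/-- The moment map `F^P`, sending `Q` to the moments of `P / Q` for `k = 0, 1, …, n`. The zeroth
moment is real, see `ratMoment_zero_im`. -/
def momentMap {n : ℕ} (N : ℕ) (P Q : HermCoeffs n) : HermCoeffs n :=
  ((ratMoment N P Q 0).re, fun k : Fin n => ratMoment N P Q ((k : ℤ) + 1))

/-- The map `G^c`, sending `P` to the `Q ∈ 𝔓₊(N)` with `F^P(Q) = c`. -/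
def solutionMap (n N : ℕ) (c P : HermCoeffs n) : HermCoeffs n :=
  Function.invFunOn (momentMap N P) (posCone n N) c

/-- All solutions for the data `c`: those `Q ∈ 𝔓₊(N)` for which `P / Q` has the moments `c` for
some `P ∈ 𝔓₊(N)`. -/
def solutionSet (n N : ℕ) (c : HermCoeffs n) : Set (HermCoeffs n) :=
  {Q | Q ∈ posCone n N ∧ ∃ P ∈ posCone n N, momentMap N P Q = c}

theorem HermCoeffs.conj_coeff {n : ℕ} (p : HermCoeffs n) (k : ℤ) :
    conj (p.coeff k) = p.coeff (-k) := by
  unfold HermCoeffs.coeff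
  rcases lt_trichotomy k 0 with h | h | h
  · have h1 : ¬ (0 < k) := by omega
    have h2 : k ≠ 0 := by omega
    simp only [h1, h2, Int.natAbs_neg, neg_eq_zero, if_false]
    split_ifs <;> first | omega | simp
  · simp [h]
  · have h2 : k ≠ 0 := by omega
    simp only [h, h2, Int.natAbs_neg, neg_eq_zero, if_false, if_true]
    split_ifs <;> first | omega | simp

theorem sum_symm_Icc (n : ℕ) (f : ℤ → ℂ) :
    ∑ k ∈ Finset.Icc (-(n : ℤ)) n, f (-k) = ∑ k ∈ Finset.Icc (-(n : ℤ)) n, f k := by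
  refine Finset.sum_nbij' (fun k => -k) (fun k => -k) ?_ ?_ ?_ ?_ ?_ <;>
    intro k hk <;> simp at hk ⊢ <;> omega

theorem HermCoeffs.eval_im {n : ℕ} (p : HermCoeffs n) {z : ℂ} (hz : ‖z‖ = 1) :
    (p.eval z).im = 0 := by
  rw [← Complex.conj_eq_iff_im, HermCoeffs.eval, map_sum,
    ← sum_symm_Icc n (fun k => p.coeff k * z ^ (-k))]
  refine Finset.sum_congr rfl fun k _ => ?_
  rw [map_mul, p.conj_coeff, map_zpow₀, ← Complex.inv_eq_conj hz, inv_zpow', neg_neg]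

theorem pairing_im {n : ℕ} (c p : HermCoeffs n) : (pairing c p).im = 0 := by
  rw [← Complex.conj_eq_iff_im, pairing, map_sum,
    ← sum_symm_Icc n (fun k => c.coeff k * conj (p.coeff k))]
  refine Finset.sum_congr rfl fun k _ => ?_
  rw [map_mul, c.conj_coeff, p.conj_coeff k]

theorem norm_zetaPt (N : ℕ) (j : ℤ) : ‖zetaPt N j‖ = 1 := by
  have h : Complex.I * (Real.pi * j / N) = ((Real.pi * j / N : ℝ) : ℂ) * Complex.I := by
    push_cast; ring
  rw [zetaPt, h, Complex.norm_exp_ofReal_mul_I]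

theorem ratMoment_zero_im {n : ℕ} (N : ℕ) (P Q : HermCoeffs n) :
    (ratMoment N P Q 0).im = 0 := by
  rw [← Complex.conj_eq_iff_im, ratMoment, discreteIntegral, map_mul, map_sum]
  congr 1
  · rw [map_div₀, map_mul, map_one, Complex.conj_natCast, map_ofNat]
  · refine Finset.sum_congr rfl fun j _ => ?_
    have h1 := Complex.conj_eq_iff_im.2 (P.eval_im (norm_zetaPt N j))
    have h2 := Complex.conj_eq_iff_im.2 (Q.eval_im (norm_zetaPt N j))
    simp [h1, h2]

end

/-! Pair moments with polynomials. The moment vector of a mass `1/(2N)` at `ζ_j` acts as evaluation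
at `ζ_j`, up to the factor `1/(2N)`, so `⟨F^P(Q), R⟩` is the average of `P R / Q` over the nodes. A
symmetric `R` of degree at most `n < N` vanishing at all `2N` nodes is zero. Testing with a suitable
`R` therefore yields a weighted sum of squares, which forces injectivity of `F^P`, of its
derivative, and of the linear map `P ↦ F^P(Q)` (`eq_zero_of_sum_sq`). By the inverse function
theorem `F^P` is a diffeomorphism onto an open image. That image is also relatively closed in the
dual cone, because `F^P` is proper over it (`exists_compact_of_op_near`). The dual cone is convex,
hence connected, so the image is all of it. For fixed `c`, linearity in `P` gives a smooth `Q ↦ P`.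
Restricted to the `Q` with `P` positive, it is again an injective immersion in equal dimensions, and
its inverse is `G^c`. -/

noncomputable section

open Filter Topology

/-! ### Global inverses from injectivity and invertible derivatives -/

section LocalInverse

variable {E : Type*} [NormedAddCommGroup E] [NormedSpace ℝ E] [FiniteDimensional ℝ E]

/-- An injective endomorphism of a finite-dimensional space as a continuous linear equivalence. -/
theorem exists_continuousLinearEquiv_of_ker_eq_zero (f : E →L[ℝ] E) (hf : ∀ h, f h = 0 → h = 0) :
    ∃ g : E ≃L[ℝ] E, (g : E →L[ℝ] E) = f :=
  ⟨(LinearEquiv.ofInjectiveEndo (f : E →ₗ[ℝ] E)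
    ((injective_iff_map_eq_zero _).2 hf)).toContinuousLinearEquiv, by ext x; rfl⟩

/-- A smooth injective map with injective derivatives on an open set of a finite-dimensional space
is a diffeomorphism onto its image, which is open. -/
theorem exists_openPartialHomeomorph_of_contDiffAt {U : Set E} (hU : IsOpen U) {f : E → E}
    (hinj : InjOn f U) (hf : ∀ x ∈ U, ContDiffAt ℝ ∞ f x)
    (hd : ∀ x ∈ U, ∀ h, fderiv ℝ f x h = 0 → h = 0) :
    ∃ e : OpenPartialHomeomorph E E, e.source = U ∧ e.target = f '' U ∧ ⇑e = f ∧
      ContDiffOn ℝ ∞ e e.source ∧ ContDiffOn ℝ ∞ e.symm e.target := by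
  have : CompleteSpace E := FiniteDimensional.complete ℝ E
  have hopen : IsOpenMap (U.domRestrict f) := by
    refine IsOpenMap.of_nhds_le fun x => ?_
    obtain ⟨g, hg⟩ := exists_continuousLinearEquiv_of_ker_eq_zero _ (hd x x.2)
    have hs := (hf x x.2).hasStrictFDerivAt (by simp)
    rw [← hg] at hs
    have h1 : map (U.domRestrict f) (𝓝 x) = map f (map Subtype.val (𝓝 x)) := by
      rw [map_map]; rfl
    rw [h1, map_nhds_subtype_coe_eq_nhds x.2 (hU.mem_nhds x.2), hs.map_nhds_eq_of_equiv]
    rfl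
  have hsm : ContDiffOn ℝ ∞ f U := fun x hx => (hf x hx).contDiffWithinAt
  refine ⟨OpenPartialHomeomorph.ofContinuousOpenRestrict (hinj.toPartialEquiv f U)
    hsm.continuousOn hopen hU, rfl, rfl, rfl, hsm, ?_⟩
  set e := OpenPartialHomeomorph.ofContinuousOpenRestrict (hinj.toPartialEquiv f U)
    hsm.continuousOn hopen hU
  intro y hy
  have hx : e.symm y ∈ U := e.map_target hy
  obtain ⟨g, hg⟩ := exists_continuousLinearEquiv_of_ker_eq_zero _ (hd _ hx)
  have hs := ((hf _ hx).hasStrictFDerivAt (by simp)).hasFDerivAt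
  rw [← hg] at hs
  exact (e.contDiffAt_symm hy hs (hf _ hx)).contDiffWithinAt

end LocalInverse

/-! ### Abstract moment problem: cone, dual cone, coercivity -/

/-- Linear functionals `L j` separating the points of `E`, and vectors `v j` which represent
them, up to a positive factor, in a bilinear pairing. -/
structure MomentData (ι E : Type*) [NormedAddCommGroup E] [NormedSpace ℝ E] where
  L : ι → E →L[ℝ] ℝ
  v : ι → E
  B : E →L[ℝ] E →L[ℝ] ℝ
  w : ℝ
  w_pos : 0 < w
  B_v : ∀ j R, B (v j) R = w * L j R
  eq_zero : ∀ R, (∀ j, L j R = 0) → R = 0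
  unit : E
  unit_pos : ∀ j, 0 < L j unit

namespace MomentData

variable {ι E : Type*} [NormedAddCommGroup E] [NormedSpace ℝ E]
  (D : MomentData ι E)

/-- The open cone where all functionals are positive. -/
def cone : Set E := {P | ∀ j, 0 < D.L j P}

/-- The vectors pairing positively with the nonzero elements of the closed cone. -/
def dual : Set E := {c | ∀ P ∈ closure D.cone, P ≠ 0 → 0 < D.B c P}

theorem closure_cone_subset : closure D.cone ⊆ {P | ∀ j, 0 ≤ D.L j P} := by
  refine closure_minimal (fun P hP j => (hP j).le) ?_
  simp only [ofPred_forall]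
  exact isClosed_iInter fun j => isClosed_le continuous_const (D.L j).continuous

theorem convex_dual : Convex ℝ D.dual := by
  intro c hc c' hc' a b ha hb hab P hP hP0
  have h1 := hc P hP hP0
  have h2 := hc' P hP hP0
  simp only [map_add, map_smul, add_apply, smul_apply,
    smul_eq_mul]
  rcases ha.eq_or_lt with rfl | ha
  · have : b = 1 := by linarith
    simp [this, h2]
  · have := mul_pos ha h1
    have := mul_nonneg hb h2.le
    linarith

theorem smul_mem_closure_cone {P : E} (hP : P ∈ closure D.cone) {t : ℝ} (ht : 0 < t) :
    t • P ∈ closure D.cone := by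
  refine map_mem_closure (continuous_const_smul t) hP fun R hR j => ?_
  rw [map_smul]
  exact mul_pos ht (hR j)

/-- Near an element of the dual cone the pairing is uniformly coercive on the closed cone. -/
theorem exists_coercive [FiniteDimensional ℝ E] {c : E} (hc : c ∈ D.dual) :
    ∃ ε > 0, ∀ᶠ c' in 𝓝 c, ∀ P ∈ closure D.cone, ε * ‖P‖ ≤ D.B c' P := by
  have : ProperSpace E := FiniteDimensional.proper ℝ E
  have hK : IsCompact (closure D.cone ∩ Metric.sphere 0 1) :=
    (isCompact_sphere 0 1).inter_left isClosed_closure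
  obtain ⟨ε, hε, hεB⟩ : ∃ ε > 0, ∀ P ∈ closure D.cone ∩ Metric.sphere 0 1, ε ≤ D.B c P := by
    refine hK.exists_forall_le' (D.B c).continuous.continuousOn (a := 0) fun P hP => ?_
    refine hc P hP.1 ?_
    rintro rfl
    simpa using hP.2
  have hev : ∀ᶠ c' in 𝓝 c, ‖D.B c' - D.B c‖ < ε / 2 := by
    have h1 : Continuous fun c' => ‖D.B c' - D.B c‖ := by fun_prop
    exact h1.continuousAt.eventually_lt continuousAt_const (by simpa using hε)
  refine ⟨ε / 2, half_pos hε, hev.mono fun c' hc' P hP => ?_⟩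
  rcases eq_or_ne P 0 with rfl | hP0
  · simp
  have hn : 0 < ‖P‖ := norm_pos_iff.2 hP0
  have h1 := hεB (‖P‖⁻¹ • P) ⟨D.smul_mem_closure_cone hP (inv_pos.2 hn), by
    simp [norm_smul, hn.ne']⟩
  rw [map_smul, smul_eq_mul, inv_mul_eq_div, le_div_iff₀ hn] at h1
  have h2 := (D.B c' - D.B c).le_opNorm P
  rw [sub_apply, Real.norm_eq_abs] at h2
  have h3 := (abs_le.1 h2).1
  have h4 := mul_le_mul_of_nonneg_right hc'.le hn.le
  linarith

variable [Fintype ι]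

/-! ### The moment operator: injectivity and derivatives -/

/-- The operator `P ↦ ∑ j, (L j P / L j Q) • v j`. -/
def op (Q : E) : E →L[ℝ] E := ∑ j, (D.L j Q)⁻¹ • (D.L j).smulRight (D.v j)

theorem op_apply (Q P : E) : D.op Q P = ∑ j, (D.L j P / D.L j Q) • D.v j := by
  simp only [op, sum_apply, smul_apply,
    ContinuousLinearMap.smulRight_apply, smul_smul]
  exact Finset.sum_congr rfl fun j _ => by rw [mul_comm, div_eq_mul_inv]

theorem B_sum (a : ι → ℝ) (R : E) :
    D.B (∑ j, a j • D.v j) R = D.w * ∑ j, a j * D.L j R := by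
  simp only [map_sum, map_smul, sum_apply, smul_apply,
    D.B_v, smul_eq_mul, Finset.mul_sum]
  exact Finset.sum_congr rfl fun j _ => by ring

/-- Pairing the vanishing sum with `R` itself gives `w ∑ a_j (L_j R)² = 0`, and the `L_j` separate
points. All the injectivity statements below reduce to this. -/
theorem eq_zero_of_sum_sq {a : ι → ℝ} (ha : ∀ j, 0 < a j) {R : E}
    (h : ∑ j, (a j * D.L j R) • D.v j = 0) : R = 0 := by
  have h1 := D.B_sum (fun j => a j * D.L j R) R
  rw [h, map_zero, zero_apply, eq_comm, mul_eq_zero,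
    or_iff_right D.w_pos.ne', Finset.sum_eq_zero_iff_of_nonneg] at h1
  · refine D.eq_zero R fun j => ?_
    have h2 := h1 j (Finset.mem_univ j)
    simpa [(ha j).ne'] using h2
  · intro j _
    rw [mul_assoc]
    exact mul_nonneg (ha j).le (mul_self_nonneg _)

theorem isOpen_cone : IsOpen D.cone := by
  simp only [cone, ofPred_forall]
  exact isOpen_iInter_of_finite fun j => isOpen_lt continuous_const (D.L j).continuous

theorem op_mem_dual {P Q : E} (hP : P ∈ D.cone) (hQ : Q ∈ D.cone) : D.op Q P ∈ D.dual := by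
  intro R hR hR0
  rw [op_apply, B_sum]
  have hR' := D.closure_cone_subset hR
  refine mul_pos D.w_pos (Finset.sum_pos' (fun j _ => mul_nonneg (div_pos (hP j) (hQ j)).le
    (hR' j)) ?_)
  by_contra! hcon
  refine hR0 (D.eq_zero R fun j => le_antisymm ?_ (hR' j))
  by_contra! hj
  exact (hcon j (Finset.mem_univ j)).not_gt (mul_pos (div_pos (hP j) (hQ j)) hj)

theorem op_injective {Q : E} (hQ : Q ∈ D.cone) {P : E} (h : D.op Q P = 0) : P = 0 := by
  refine D.eq_zero_of_sum_sq (fun j => inv_pos.2 (hQ j)) ?_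
  rw [← h, op_apply]
  exact Finset.sum_congr rfl fun j _ => by rw [div_eq_inv_mul]

/-- `P/Q' - P/Q = P (Q - Q') / (Q Q')` at each node, a positive weight times `Q - Q'`. -/
theorem injOn_op {P : E} (hP : P ∈ D.cone) : InjOn (fun Q => D.op Q P) D.cone := by
  intro Q hQ Q' hQ' h
  rw [← sub_eq_zero]
  refine D.eq_zero_of_sum_sq (a := fun j => D.L j P / (D.L j Q * D.L j Q'))
    (fun j => div_pos (hP j) (mul_pos (hQ j) (hQ' j))) ?_
  have h1 := sub_eq_zero.2 h.symm
  simp only [op_apply, ← Finset.sum_sub_distrib, ← sub_smul] at h1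
  rw [← h1]
  refine Finset.sum_congr rfl fun j _ => ?_
  have := (hQ j).ne'
  have := (hQ' j).ne'
  rw [map_sub]
  congr 1
  field_simp

theorem hasFDerivAt_op {Q : E} (hQ : Q ∈ D.cone) :
    HasFDerivAt D.op (∑ j, ((-(D.L j Q ^ 2)⁻¹) • D.L j).smulRight
      ((D.L j).smulRight (D.v j))) Q := by
  refine HasFDerivAt.fun_sum fun j _ => ?_
  have h1 : HasFDerivAt (fun R => (D.L j R)⁻¹) (-(D.L j Q ^ 2)⁻¹ • D.L j) Q :=
    (hasDerivAt_inv (hQ j).ne').comp_hasFDerivAt Q (D.L j).hasFDerivAt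
  exact h1.smul_const (𝕜' := ℝ) ((D.L j).smulRight (D.v j))

theorem contDiffAt_op {Q : E} (hQ : Q ∈ D.cone) : ContDiffAt ℝ ∞ D.op Q := by
  refine ContDiffAt.sum fun j _ => ContDiffAt.fun_smul ?_ contDiffAt_const
  exact (D.L j).contDiff.contDiffAt.inv (hQ j).ne'

/-- The derivative of `P/Q` in direction `h` is `-(P/Q²) h` at each node, again with a weight of
constant sign. -/
theorem eq_zero_of_fderiv_op {P Q : E} (hP : P ∈ D.cone) (hQ : Q ∈ D.cone) {h : E}
    (hh : fderiv ℝ D.op Q h P = 0) : h = 0 := by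
  refine D.eq_zero_of_sum_sq (a := fun j => (D.L j Q ^ 2)⁻¹ * D.L j P)
    (fun j => mul_pos (inv_pos.2 (pow_pos (hQ j) 2)) (hP j)) ?_
  rw [(D.hasFDerivAt_op hQ).fderiv] at hh
  simp only [sum_apply, smul_apply,
    ContinuousLinearMap.smulRight_apply, smul_smul, smul_eq_mul] at hh
  rw [← neg_eq_zero, ← hh, ← Finset.sum_neg_distrib]
  refine Finset.sum_congr rfl fun j _ => ?_
  rw [← neg_smul]
  congr 1
  ring

variable [FiniteDimensional ℝ E]

/-! ### Properness and surjectivity for fixed numerator -/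

/-- The map `Q ↦ op Q P` as a diffeomorphism onto its image. -/
theorem exists_op_homeomorph {P : E} (hP : P ∈ D.cone) :
    ∃ e : OpenPartialHomeomorph E E, e.source = D.cone ∧
      e.target = (fun Q => D.op Q P) '' D.cone ∧ ⇑e = (fun Q => D.op Q P) ∧
      ContDiffOn ℝ ∞ e e.source ∧ ContDiffOn ℝ ∞ e.symm e.target := by
  refine exists_openPartialHomeomorph_of_contDiffAt D.isOpen_cone (D.injOn_op hP)
    (fun Q hQ => (D.contDiffAt_op hQ).clm_apply contDiffAt_const) fun Q hQ h hh => ?_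
  refine D.eq_zero_of_fderiv_op hP hQ ?_
  have h1 := ((D.hasFDerivAt_op hQ).differentiableAt.hasFDerivAt.clm_apply
    (hasFDerivAt_const P Q)).fderiv
  rw [h1] at hh
  simpa using hh

/-- Properness of `Q ↦ op Q P` over the dual cone: solutions for data near `c` neither escape to
infinity nor approach the boundary of the cone. -/
theorem exists_compact_of_op_near {P : E} (hP : P ∈ D.cone) {c : E} (hc : c ∈ D.dual) :
    ∃ K ⊆ D.cone, IsCompact K ∧ ∀ᶠ c' in 𝓝 c, ∀ Q ∈ D.cone, D.op Q P = c' → Q ∈ K := by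
  have : ProperSpace E := FiniteDimensional.proper ℝ E
  obtain ⟨ε, hε, hco⟩ := D.exists_coercive hc
  set S := D.w * ∑ j, D.L j P
  set T := D.B c D.unit + 1
  have hT : ∀ᶠ c' in 𝓝 c, D.B c' D.unit < T := by
    have h1 : Continuous fun c' => D.B c' D.unit := by fun_prop
    exact h1.continuousAt.eventually_lt continuousAt_const (by simp [T])
  have hTpos : 0 < T := by
    have h1 := hco.self_of_nhds D.unit (subset_closure D.unit_pos)
    have h2 := mul_nonneg hε.le (norm_nonneg D.unit)
    simp only [T]
    linarith
  set δ : ι → ℝ := fun j => D.w * (D.L j P * D.L j D.unit) / T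
  have hδ : ∀ j, 0 < δ j := fun j =>
    div_pos (mul_pos D.w_pos (mul_pos (hP j) (D.unit_pos j))) hTpos
  refine ⟨Metric.closedBall 0 (S / ε) ∩ {Q | ∀ j, δ j ≤ D.L j Q},
    fun Q hQ j => (hδ j).trans_le (hQ.2 j), ?_, ?_⟩
  · refine (isCompact_closedBall 0 _).inter_right ?_
    simp only [ofPred_forall]
    exact isClosed_iInter fun j => isClosed_le continuous_const (D.L j).continuous
  filter_upwards [hco, hT] with c' h1 h2 Q hQ hQc
  constructor
  -- Pairing `c' = op Q P` with `Q` cancels the denominators and leaves `S`, independent of `Q`;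
  -- coercivity then bounds the norm of `Q`.
  · rw [mem_closedBall_zero_iff, le_div_iff₀ hε, mul_comm]
    refine (h1 Q (subset_closure hQ)).trans_eq ?_
    rw [← hQc, op_apply, B_sum]
    simp only [S]
    congr 1
    exact Finset.sum_congr rfl fun j _ => div_mul_cancel₀ _ (hQ j).ne'
  -- Pairing `c'` with `unit` gives a sum of positive terms that is less than `T`. Each term is thus
  -- at most `T`, which keeps `L_j Q` above `δ_j`.
  · intro j
    simp only [δ]
    rw [div_le_iff₀ hTpos, mul_comm (D.L j Q), ← div_le_iff₀ (hQ j)]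
    refine le_trans ?_ h2.le
    rw [← hQc, op_apply, B_sum, mul_div_assoc]
    refine mul_le_mul_of_nonneg_left ?_ D.w_pos.le
    rw [mul_div_right_comm]
    exact Finset.single_le_sum (f := fun j => D.L j P / D.L j Q * D.L j D.unit)
      (fun i _ => (mul_pos (div_pos (hP i) (hQ i)) (D.unit_pos i)).le) (Finset.mem_univ j)

theorem image_op_eq_dual {P : E} (hP : P ∈ D.cone) :
    (fun Q => D.op Q P) '' D.cone = D.dual := by
  obtain ⟨e, -, het, -⟩ := D.exists_op_homeomorph hP
  have hsub : (fun Q => D.op Q P) '' D.cone ⊆ D.dual := by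
    rintro _ ⟨Q, hQ, rfl⟩
    exact D.op_mem_dual hP hQ
  refine hsub.antisymm (D.convex_dual.isPreconnected.subset_of_closure_inter_subset
    (het ▸ e.open_target) ?_ ?_)
  · exact ⟨_, D.op_mem_dual hP D.unit_pos, mem_image_of_mem _ D.unit_pos⟩
  · rintro c ⟨hcl, hc⟩
    obtain ⟨K, hKC, hK, hev⟩ := D.exists_compact_of_op_near hP hc
    have hKim : IsClosed ((fun Q => D.op Q P) '' K) :=
      (hK.image_of_continuousOn fun Q hQ => ((D.contDiffAt_op (hKC hQ)).clm_apply
        contDiffAt_const).continuousAt.continuousWithinAt).isClosed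
    -- Data in the image close to `c` come from the compact set `K`, whose image is closed, so the
    -- limit `c` is attained.
    refine image_mono hKC (hKim.mem_of_frequently_of_tendsto (b := 𝓝 c) (f := id) ?_ tendsto_id)
    refine ((mem_closure_iff_frequently.1 hcl).and_eventually hev).mono ?_
    rintro c' ⟨⟨Q, hQ, hQc⟩, h⟩
    exact ⟨Q, h Q hQ hQc, hQc⟩

/-! ### Parameterization of the solutions for fixed data -/

/-- The `P` with `op Q P = c`. -/
def numerator (c Q : E) : E := (D.op Q).inverse c

theorem op_numerator {Q : E} (hQ : Q ∈ D.cone) (c : E) : D.op Q (D.numerator c Q) = c := by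
  obtain ⟨g, hg⟩ := exists_continuousLinearEquiv_of_ker_eq_zero (D.op Q)
    fun _ => D.op_injective hQ
  rw [numerator, ← hg, ContinuousLinearMap.inverse_equiv]
  simp

theorem op_eq_iff {Q : E} (hQ : Q ∈ D.cone) {c P : E} :
    D.op Q P = c ↔ P = D.numerator c Q := by
  constructor
  · intro h
    rw [← sub_eq_zero]
    refine D.op_injective hQ ?_
    rw [map_sub, h, D.op_numerator hQ, sub_self]
  · rintro rfl
    exact D.op_numerator hQ c

theorem contDiffAt_numerator {Q : E} (hQ : Q ∈ D.cone) (c : E) :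
    ContDiffAt ℝ ∞ (D.numerator c) Q := by
  have : CompleteSpace E := FiniteDimensional.complete ℝ E
  obtain ⟨g, hg⟩ := exists_continuousLinearEquiv_of_ker_eq_zero (D.op Q)
    fun _ => D.op_injective hQ
  have h1 : ContDiffAt ℝ ∞ ContinuousLinearMap.inverse (D.op Q) :=
    hg ▸ contDiffAt_map_inverse g
  exact (h1.comp Q (D.contDiffAt_op hQ)).clm_apply contDiffAt_const

/-- Differentiate `op R (numerator c R) = c` at `Q`: if the numerator is stationary along `h`, only
the derivative of `op` along `h` remains, and it must vanish. -/
theorem eq_zero_of_fderiv_numerator {c Q : E} (hQ : Q ∈ D.cone) (hP : D.numerator c Q ∈ D.cone)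
    {h : E} (hh : fderiv ℝ (D.numerator c) Q h = 0) : h = 0 := by
  refine D.eq_zero_of_fderiv_op hP hQ ?_
  have h1 := (D.hasFDerivAt_op hQ).differentiableAt.hasFDerivAt.clm_apply
    ((D.contDiffAt_numerator hQ c).differentiableAt (by simp)).hasFDerivAt
  have h2 : (fun R => D.op R (D.numerator c R)) =ᶠ[𝓝 Q] fun _ => c :=
    (D.isOpen_cone.eventually_mem hQ).mono fun R hR => D.op_numerator hR c
  have h3 := congrArg (fun A => A h)
    (h1.unique ((hasFDerivAt_const c Q).congr_of_eventuallyEq h2))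
  simpa [hh] using h3

/-- For fixed `c`, the solutions `Q` of `op Q P = c` are smoothly parameterized by `P`. -/
theorem exists_solution_homeomorph {c : E} (hc : c ∈ D.dual) :
    ∃ e : OpenPartialHomeomorph E E, e.source = D.cone ∧
      e.target = {Q | Q ∈ D.cone ∧ ∃ P ∈ D.cone, D.op Q P = c} ∧
      (∀ P ∈ D.cone, e P ∈ D.cone ∧ D.op (e P) P = c) ∧
      ContDiffOn ℝ ∞ e e.source ∧ ContDiffOn ℝ ∞ e.symm e.target := by
  have hU : {Q | Q ∈ D.cone ∧ ∃ P ∈ D.cone, D.op Q P = c} =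
      D.cone ∩ D.numerator c ⁻¹' D.cone := by
    ext Q
    refine and_congr_right fun hQ => ?_
    simp [D.op_eq_iff hQ]
  have hopen : IsOpen (D.cone ∩ D.numerator c ⁻¹' D.cone) :=
    ContinuousOn.isOpen_inter_preimage (fun Q hQ =>
      (D.contDiffAt_numerator hQ c).continuousAt.continuousWithinAt) D.isOpen_cone D.isOpen_cone
  obtain ⟨e, hs, ht, he, h1, h2⟩ := exists_openPartialHomeomorph_of_contDiffAt hopen
    (f := D.numerator c) (fun Q hQ Q' hQ' h => D.injOn_op hQ.2 hQ.1 hQ'.1 (by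
      simp only
      rw [D.op_numerator hQ.1, h, D.op_numerator hQ'.1]))
    (fun Q hQ => D.contDiffAt_numerator hQ.1 c)
    fun Q hQ h hh => D.eq_zero_of_fderiv_numerator hQ.1 hQ.2 hh
  have ht' : e.target = D.cone := by
    rw [ht]
    refine Subset.antisymm (by rintro _ ⟨Q, hQ, rfl⟩; exact hQ.2) fun P hP => ?_
    -- Every positive `P` occurs as a numerator, by surjectivity of the moment map for that `P`.
    obtain ⟨Q, hQ, hQc⟩ := (D.image_op_eq_dual hP).ge hc
    have h3 := (D.op_eq_iff hQ).1 hQc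
    exact ⟨Q, ⟨hQ, by rw [mem_preimage, ← h3]; exact hP⟩, h3.symm⟩
  refine ⟨e.symm, ht', hs.trans hU.symm, fun P hP => ?_, h2, by simpa using h1⟩
  have hm : e.symm P ∈ e.source := e.map_target (ht'.symm ▸ hP)
  rw [hs] at hm
  refine ⟨hm.1, (D.op_eq_iff hm.1).2 ?_⟩
  rw [← he, e.right_inv (ht'.symm ▸ hP)]

end MomentData

/-! ### Symmetric trigonometric polynomials -/

namespace HermCoeffs

variable {n : ℕ}

theorem coeff_add (p q : HermCoeffs n) (k : ℤ) : (p + q).coeff k = p.coeff k + q.coeff k := by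
  unfold coeff
  split_ifs <;> simp

theorem coeff_smul (a : ℝ) (p : HermCoeffs n) (k : ℤ) : (a • p).coeff k = a * p.coeff k := by
  unfold coeff
  split_ifs <;> simp

theorem coeff_natCast_add_one (p : HermCoeffs n) (i : Fin n) : p.coeff ((i : ℤ) + 1) = p.2 i := by
  have h1 : ((i : ℤ) + 1).natAbs = i + 1 := by omega
  have h2 : (0 : ℤ) < (i : ℤ) + 1 := by omega
  simp [coeff, h2, h2.ne', h1]

theorem eq_zero_of_coeff {p : HermCoeffs n} (h : ∀ k ∈ Finset.Icc (-(n : ℤ)) n, p.coeff k = 0) :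
    p = 0 := by
  refine Prod.ext ?_ (funext fun i => ?_)
  · have h0 := h 0 (by simp)
    simpa [coeff] using h0
  · rw [← p.coeff_natCast_add_one]
    exact h _ (by simp only [Finset.mem_Icc]; omega)

theorem eval_add (p q : HermCoeffs n) (z : ℂ) : (p + q).eval z = p.eval z + q.eval z := by
  simp only [eval, coeff_add, add_mul, Finset.sum_add_distrib]

theorem eval_smul (a : ℝ) (p : HermCoeffs n) (z : ℂ) : (a • p).eval z = a * p.eval z := by
  simp only [eval, coeff_smul, mul_assoc, Finset.mul_sum]

theorem ofReal_re_eval (p : HermCoeffs n) {z : ℂ} (hz : ‖z‖ = 1) :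
    ((p.eval z).re : ℂ) = p.eval z :=
  Complex.ext rfl (by simp [p.eval_im hz])

/-- The evaluation `p ↦ Re p(z)` as a continuous linear functional. -/
def evalCLM (z : ℂ) : HermCoeffs n →L[ℝ] ℝ :=
  LinearMap.toContinuousLinearMap
    { toFun := fun p => (p.eval z).re
      map_add' := fun p q => by simp [eval_add]
      map_smul' := fun a p => by simp [eval_smul] }

theorem evalCLM_apply (z : ℂ) (p : HermCoeffs n) : evalCLM z p = (p.eval z).re := rfl

/-- A symmetric trigonometric polynomial of degree `n` with more than `2 n` zeros vanishes. -/
theorem eq_zero_of_eval {p : HermCoeffs n} {s : Finset ℂ} (hs : ∀ z ∈ s, z ≠ 0)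
    (h : ∀ z ∈ s, p.eval z = 0) (hcard : 2 * n < s.card) : p = 0 := by
  -- `z^n p(z)` is an ordinary polynomial of degree at most `2n`; its coefficient at `m` is
  -- `p_{n-m}`.
  set f : Polynomial ℂ := ∑ m ∈ Finset.range (2 * n + 1),
    Polynomial.monomial m (p.coeff ((n : ℤ) - m)) with hf
  have hfe : ∀ z : ℂ, z ≠ 0 → f.eval z = z ^ n * p.eval z := by
    intro z hz
    rw [hf, Polynomial.eval_finsetSum, eval, Finset.mul_sum]
    refine Finset.sum_nbij' (fun m => (n : ℤ) - m) (fun k => ((n : ℤ) - k).toNat) ?_ ?_ ?_ ?_ ?_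
    · intro m hm; simp at hm ⊢; omega
    · intro k hk; simp at hk ⊢; omega
    · intro m hm; simp
    · intro k hk; simp at hk ⊢; omega
    · intro m hm
      rw [Polynomial.eval_monomial, mul_left_comm, ← zpow_natCast z n, ← zpow_add₀ hz,
        ← zpow_natCast z m]
      congr 2
      ring
  have hdeg : f.natDegree ≤ 2 * n := by
    refine Polynomial.natDegree_sum_le_of_forall_le _ _ fun m hm => ?_
    refine (Polynomial.natDegree_monomial_le _).trans ?_
    simp at hm
    omega
  have hf0 : f = 0 := Polynomial.eq_zero_of_natDegree_lt_card_of_eval_eq_zero' f s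
    (fun z hz => by rw [hfe z (hs z hz), h z hz, mul_zero]) (hdeg.trans_lt hcard)
  refine eq_zero_of_coeff fun k hk => ?_
  rw [Finset.mem_Icc] at hk
  have h1 : f.coeff ((n : ℤ) - k).toNat = p.coeff k := by
    rw [hf, Polynomial.finsetSum_coeff, Finset.sum_eq_single ((n : ℤ) - k).toNat]
    · rw [Polynomial.coeff_monomial, if_pos rfl]
      congr 1
      omega
    · intro m _ hm
      rw [Polynomial.coeff_monomial, if_neg hm]
    · intro hm
      simp at hm
      omega
  rw [← h1, hf0, Polynomial.coeff_zero]

/-- The moments `a z ^ k` of a point mass `a` at `z`. -/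
def pointMoments (a : ℝ) (z : ℂ) : HermCoeffs n := (a, fun k => a * z ^ ((k : ℤ) + 1))

theorem coeff_pointMoments (a : ℝ) {z : ℂ} (hz : ‖z‖ = 1) {k : ℤ}
    (hk : k ∈ Finset.Icc (-(n : ℤ)) n) : (pointMoments a z : HermCoeffs n).coeff k = a * z ^ k := by
  rw [Finset.mem_Icc] at hk
  have hpos : ∀ k : ℤ, 0 < k → k ≤ n →
      (pointMoments a z : HermCoeffs n).coeff k = a * z ^ k := by
    intro k h0 hk
    have h1 : k = ((⟨k.natAbs - 1, by omega⟩ : Fin n) : ℤ) + 1 := by simp; omega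
    rw [h1, coeff_natCast_add_one]
    rfl
  rcases lt_trichotomy k 0 with h | rfl | h
  · rw [← neg_neg k, ← conj_coeff, hpos (-k) (by omega) (by omega), map_mul, map_zpow₀,
      ← Complex.inv_eq_conj hz, inv_zpow', Complex.conj_ofReal]
  · simp [coeff, pointMoments]
  · exact hpos k h hk.2

theorem pairing_pointMoments (a : ℝ) {z : ℂ} (hz : ‖z‖ = 1) (p : HermCoeffs n) :
    pairing (pointMoments a z) p = a * p.eval z := by
  rw [← Complex.conj_eq_iff_im.2 (p.eval_im hz), eval, map_sum, Finset.mul_sum, pairing]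
  refine Finset.sum_congr rfl fun k hk => ?_
  rw [coeff_pointMoments a hz hk, map_mul, map_zpow₀, ← Complex.inv_eq_conj hz, inv_zpow',
    neg_neg]
  ring

/-- The pairing as a continuous bilinear map. -/
def pairingCLM : HermCoeffs n →L[ℝ] HermCoeffs n →L[ℝ] ℝ :=
  LinearMap.toContinuousBilinearMap <| LinearMap.mk₂ ℝ (fun c p => (pairing c p).re)
    (fun c c' p => by simp only [pairing, coeff_add, add_mul, Finset.sum_add_distrib,
      Complex.add_re])
    (fun a c p => by simp only [pairing, coeff_smul, mul_assoc, ← Finset.mul_sum,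
      Complex.re_ofReal_mul, smul_eq_mul])
    (fun c p p' => by simp only [pairing, coeff_add, map_add, mul_add, Finset.sum_add_distrib,
      Complex.add_re])
    (fun a c p => by simp only [pairing, coeff_smul, map_mul, Complex.conj_ofReal,
      mul_left_comm _ (a : ℂ), ← Finset.mul_sum, Complex.re_ofReal_mul, smul_eq_mul])

theorem pairingCLM_apply (c p : HermCoeffs n) : pairingCLM c p = (pairing c p).re := rfl

theorem eval_one (z : ℂ) : eval (n := n) (1, 0) z = 1 := by
  rw [eval, Finset.sum_eq_single 0]
  · simp [coeff]
  · intro k _ hk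
    simp [coeff, hk]
  · simp

end HermCoeffs

/-! ### The discrete circle as an instance -/

theorem zetaPt_injOn {N : ℕ} (hN : 0 < N) :
    InjOn (zetaPt N) (Finset.Icc (-(N : ℤ) + 1) N : Finset ℤ) := by
  intro j hj k hk h
  obtain ⟨m, hm⟩ := Complex.exp_eq_exp_iff_exists_int.1 h
  simp only [Finset.coe_Icc, mem_Icc] at hj hk
  have hN' : (N : ℂ) ≠ 0 := by exact_mod_cast hN.ne'
  have h1 : (j : ℂ) = k + m * (2 * N) := by
    have h2 : (Complex.I * Real.pi) * (j : ℂ) = (Complex.I * Real.pi) * (k + m * (2 * N)) := by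
      field_simp at hm
      linear_combination Complex.I * Real.pi * hm
    exact mul_left_cancel₀ (by simp [Real.pi_ne_zero]) h2
  have h3 : j = k + m * (2 * N) := by exact_mod_cast h1
  -- The indices span fewer than `2N` integers, so `|j - k| < 2N`.
  have h4 : m = 0 := by
    by_contra hm0
    rcases lt_or_gt_of_ne hm0 with h5 | h5 <;> nlinarith
  simpa [h4] using h3

/-- The values on the discrete unit circle, together with the moments of its point masses. -/
def circleData {n N : ℕ} (hnN : n < N) :
    MomentData (Finset.Icc (-(N : ℤ) + 1) N) (HermCoeffs n) where
  L j := HermCoeffs.evalCLM (zetaPt N j)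
  v j := HermCoeffs.pointMoments (1 / (2 * N)) (zetaPt N j)
  B := HermCoeffs.pairingCLM
  w := 1 / (2 * N)
  w_pos := by
    have : (0 : ℝ) < N := by exact_mod_cast (Nat.zero_le n).trans_lt hnN
    positivity
  B_v j R := by
    rw [HermCoeffs.pairingCLM_apply, HermCoeffs.pairing_pointMoments _ (norm_zetaPt N j),
      Complex.re_ofReal_mul, HermCoeffs.evalCLM_apply]
  eq_zero R h := by
    refine HermCoeffs.eq_zero_of_eval (s := (Finset.Icc (-(N : ℤ) + 1) N).image (zetaPt N))
      ?_ ?_ ?_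
    · intro z hz
      obtain ⟨j, -, rfl⟩ := Finset.mem_image.1 hz
      exact Complex.exp_ne_zero _
    · intro z hz
      obtain ⟨j, hj, rfl⟩ := Finset.mem_image.1 hz
      have h1 := h ⟨j, hj⟩
      rw [HermCoeffs.evalCLM_apply] at h1
      rw [← R.ofReal_re_eval (norm_zetaPt N j), h1, Complex.ofReal_zero]
    -- The `2N` distinct nodes exceed the `2n` possible zeros exactly because `n < N`.
    · rw [Finset.card_image_of_injOn (zetaPt_injOn ((Nat.zero_le n).trans_lt hnN)), Int.card_Icc]
      omega
  unit := (1, 0)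
  unit_pos j := by simp [HermCoeffs.evalCLM_apply, HermCoeffs.eval_one]

theorem cone_circleData {n N : ℕ} (hnN : n < N) : (circleData hnN).cone = posCone n N := by
  ext P
  simp only [MomentData.cone, posCone, mem_ofPred_eq, Subtype.forall]
  rfl

theorem dual_circleData {n N : ℕ} (hnN : n < N) : (circleData hnN).dual = dualCone n N := by
  ext c
  simp only [MomentData.dual, dualCone, cone_circleData]
  rfl

theorem op_circleData {n N : ℕ} (hnN : n < N) (P Q : HermCoeffs n) :
    (circleData hnN).op Q P = momentMap N P Q := by
  have key : ∀ k : ℤ, ratMoment N P Q k = ∑ j : Finset.Icc (-(N : ℤ) + 1) N,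
      (((P.eval (zetaPt N j)).re / (Q.eval (zetaPt N j)).re : ℝ) : ℂ) *
        (((1 / (2 * N) : ℝ) : ℂ) * zetaPt N j ^ k) := by
    intro k
    rw [ratMoment, discreteIntegral, Finset.mul_sum, ← Finset.sum_coe_sort (Finset.Icc (-(N : ℤ) + 1) N)]
    refine Finset.sum_congr rfl fun j _ => ?_
    push_cast
    rw [P.ofReal_re_eval (norm_zetaPt N j), Q.ofReal_re_eval (norm_zetaPt N j)]
    ring
  rw [MomentData.op_apply, momentMap]
  refine Prod.ext ?_ (funext fun i => ?_)
  · rw [Prod.fst_sum, key, Complex.re_sum]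
    refine Finset.sum_congr rfl fun j _ => ?_
    rw [zpow_zero, mul_one, Complex.re_ofReal_mul, Complex.ofReal_re]
    rfl
  · rw [Prod.snd_sum, Finset.sum_apply]
    refine Eq.trans ?_ (key ((i : ℤ) + 1)).symm
    refine Finset.sum_congr rfl fun j _ => ?_
    rw [← Complex.real_smul]
    rfl

end

theorem mainTheorem2 (n N : ℕ) (hnN : n < N) :
    (∀ P ∈ posCone n N,
      ∃ e : OpenPartialHomeomorph (HermCoeffs n) (HermCoeffs n),
        e.source = posCone n N ∧ e.target = dualCone n N ∧
        (∀ Q ∈ posCone n N, e Q = momentMap N P Q) ∧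
        ContDiffOn ℝ ∞ e e.source ∧ ContDiffOn ℝ ∞ e.symm e.target) ∧
    (∀ c ∈ dualCone n N,
      (∀ P ∈ posCone n N, ∀ Q,
        (Q ∈ posCone n N ∧ momentMap N P Q = c) ↔ Q = solutionMap n N c P) ∧
      ∃ e : OpenPartialHomeomorph (HermCoeffs n) (HermCoeffs n),
        e.source = posCone n N ∧ e.target = solutionSet n N c ∧
        (∀ P ∈ posCone n N, e P = solutionMap n N c P) ∧
        ContDiffOn ℝ ∞ e e.source ∧ ContDiffOn ℝ ∞ e.symm e.target) := by
  have hinj : ∀ P ∈ posCone n N, InjOn (momentMap N P) (posCone n N) := fun P hP => by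
    have h := (circleData hnN).injOn_op (P := P) (by rwa [cone_circleData])
    simpa only [cone_circleData, op_circleData] using h
  have himg : ∀ P ∈ posCone n N, momentMap N P '' posCone n N = dualCone n N := fun P hP => by
    have h := (circleData hnN).image_op_eq_dual (P := P) (by rwa [cone_circleData])
    simpa only [cone_circleData, dual_circleData, op_circleData] using h
  refine ⟨fun P hP => ?_, fun c hc => ?_⟩
  · obtain ⟨e, hs, ht, he, h1, h2⟩ :=
      (circleData hnN).exists_op_homeomorph (P := P) (by rwa [cone_circleData])
    simp only [cone_circleData, op_circleData] at hs ht he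
    exact ⟨e, hs, ht.trans (himg P hP), fun Q _ => congrFun he Q, h1, h2⟩
  have hiff : ∀ P ∈ posCone n N, ∀ Q,
      (Q ∈ posCone n N ∧ momentMap N P Q = c) ↔ Q = solutionMap n N c P := by
    intro P hP Q
    -- Surjectivity ensures that `invFunOn` returns a genuine preimage, not its default value.
    have hex : c ∈ momentMap N P '' posCone n N := (himg P hP).ge hc
    have hmem : solutionMap n N c P ∈ posCone n N := Function.invFunOn_mem hex
    have heq : momentMap N P (solutionMap n N c P) = c := Function.invFunOn_eq hex
    constructor
    · rintro ⟨hQ, hQc⟩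
      exact hinj P hP hQ hmem (hQc.trans heq.symm)
    · rintro rfl
      exact ⟨hmem, heq⟩
  obtain ⟨e, hs, ht, he, h1, h2⟩ :=
    (circleData hnN).exists_solution_homeomorph (c := c) (by rwa [dual_circleData])
  simp only [cone_circleData, op_circleData] at hs ht he
  exact ⟨hiff, e, hs, ht, fun P hP => (hiff P hP _).1 (he P hP), h1, h2⟩
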